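/- Consider a diagonal system of hydrodynamic type $u^i_t=\lambda^i(u)\,u^i_x$, $i=1,\dots,n$ (no summation), with smooth $\lambda^i$ on an open set of $\mathbb{R}^n$. Its $i$-th Monge characteristic distribution, on the space with coordinates $(x,t,u,u_x)\in\mathbb{R}^{2n+2}$, is cut out by $$dx+\lambda^i dt=0,\quad du^i=0,\quad du^j+(\lambda^i-\lambda^j)u^j_x\,dt=0\ (j\neq i),\quad du^i_x-D_x(\lambda^i)\,u^i_x\,dt=0,$$ where $D_x(\lambda^i)=\sum_k u^k_x\,\partial_{u^k}\lambda^i$. A second (extra) Riemann invariant of it is a smooth first integral $I^i(x,t,u,u^i_x)$ of this distribution, defined on an open set, that is functionally independent of the first integral $u^i$. Let $P^i(x,t,u,s)$ denote a smooth function on an open set obtained by solving $I^i(x,t,u,q)=s$ for $q$, i.e. $I^i(x,t,u,P^i(x,t,u,s))=s$. (1) If every Monge distribution has a second Riemann invariant $I^i$ that is resolved by such a $P^i$, then for any smooth functions $\varphi_1,\dots,\varphi_n$ of one variable the exterior system $$du^i=P^i(x,t,u,\varphi_i(u^i))\,(dx+\lambda^i(u)\,dt),\qquad i=1,\dots,n,$$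 is completely integrable in the sense of Frobenius wherever it is defined in the space of $(x,t,u)$: the rank-two distribution that it cuts out is in involution, and a two-dimensional integral manifold passes through every point. (2) If all Monge distributions except the $n$-th have such a second Riemann invariant, then for any smooth functions $\varphi_1,\dots,\varphi_{n-1}$ the exterior system $$du^i=P^i(x,t,u,\varphi_i(u^i))\,(dx+\lambda^i(u)\,dt),\quad i=1,\dots,n-1,\qquad du^n=u^n_x\,(dx+\lambda^n(u)\,dt)$$ on the space of $(x,t,u,u^n_x)$ admits a Cauchy characteristic: a smooth nowhere vanishing vector field tangent to the distribution cut out by the system whose Lie bracket with every smooth vector field tangent to that distribution is again tangent to it. If all the data are real analytic, the Cauchy characteristic can be chosen real analytic. -/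

import Mathlib

open scoped ContDiff

/-! ### Distributions on open subsets of a real normed space -/

section Distributions

variable {E : Type*} [NormedAddCommGroup E] [NormedSpace ℝ E]

/-- The distribution cut out by a Pfaffian system `θ i = 0`. -/
def pfaffDistribution {ι : Type*} (θ : ι → E → (E →L[ℝ] ℝ)) (z : E) : Submodule ℝ E :=
  ⨅ i, LinearMap.ker (θ i z).toLinearMap

/-- `X` is a smooth vector field on `V` tangent to the distribution `𝒟`. -/
def IsSmoothSection (𝒟 : E → Submodule ℝ E) (V : Set E) (X : E → E) : Prop :=
  ContDiffOn ℝ ∞ X V ∧ ∀ z ∈ V, X z ∈ 𝒟 z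

/-- `𝒟` is in involution on `W`: brackets of (locally defined) smooth vector fields tangent to `𝒟`
are tangent to `𝒟`. -/
def IsInvolutiveOn (𝒟 : E → Submodule ℝ E) (W : Set E) : Prop :=
  ∀ V : Set E, IsOpen V → V ⊆ W → ∀ X Y : E → E,
    IsSmoothSection 𝒟 V X → IsSmoothSection 𝒟 V Y →
      ∀ z ∈ V, VectorField.lieBracket ℝ X Y z ∈ 𝒟 z

/-- Through `z₀` passes a (local, immersed) smooth integral manifold of `𝒟` of full dimension,
contained in `W`: its tangent spaces are exactly the subspaces of the distribution. -/
def HasIntegralManifoldAt (𝒟 : E → Submodule ℝ E) (W : Set E) (z₀ : E) : Prop :=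
  ∃ (d : ℕ) (V : Set (Fin d → ℝ)) (f : (Fin d → ℝ) → E),
    IsOpen V ∧ 0 ∈ V ∧ f 0 = z₀ ∧ ContDiffOn ℝ ∞ f V ∧ Set.MapsTo f V W ∧
      ∀ y ∈ V, Function.Injective (fderiv ℝ f y) ∧
        LinearMap.range (fderiv ℝ f y).toLinearMap = 𝒟 (f y)

/-- A Pfaffian system is completely integrable on `W` in the sense of Frobenius: its distribution
is in involution, and an integral manifold of the distribution passes through every point. -/
structure IsFrobeniusIntegrable {ι : Type*} (θ : ι → E → (E →L[ℝ] ℝ)) (W : Set E) : Prop where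
  involutive : IsInvolutiveOn (pfaffDistribution θ) W
  integralManifold : ∀ z ∈ W, HasIntegralManifoldAt (pfaffDistribution θ) W z

/-- A Pfaffian system admits a Cauchy characteristic (of class `C^r`) on `W`: there is a nowhere
vanishing vector field tangent to its distribution `𝒟` whose brackets with all (locally defined)
vector fields tangent to `𝒟` are tangent to `𝒟`. -/
def HasCauchyCharacteristic {ι : Type*} (r : WithTop ℕ∞) (θ : ι → E → (E →L[ℝ] ℝ))
    (W : Set E) : Prop :=
  ∃ C : E → E, ContDiffOn ℝ r C W ∧
    (∀ z ∈ W, C z ≠ 0 ∧ C z ∈ pfaffDistribution θ z) ∧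
    ∀ V : Set E, IsOpen V → V ⊆ W → ∀ Y : E → E, IsSmoothSection (pfaffDistribution θ) V Y →
      ∀ z ∈ V, VectorField.lieBracket ℝ C Y z ∈ pfaffDistribution θ z

end Distributions

/-! ### Diagonal systems `u^i_t = λ^i(u) u^i_x` and their Monge distributions -/

/-- The space with coordinates `(x, t, u, u_x)`. -/
abbrev Jet (n : ℕ) : Type := ℝ × ℝ × (Fin n → ℝ) × (Fin n → ℝ)

/-- The space with coordinates `(x, t, u)`. -/
abbrev Base (n : ℕ) : Type := ℝ × ℝ × (Fin n → ℝ)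

/-- The space with coordinates `(x, t, u, s)`, where `s` is one additional scalar. -/
abbrev ScalarJet (n : ℕ) : Type := ℝ × ℝ × (Fin n → ℝ) × ℝ

/-- The `i`-th Monge characteristic distribution at the point `z = (x, t, u, u_x)`, cut out by
`dx + λ^i dt = 0`, `du^i = 0`, `du^j + (λ^i - λ^j) u^j_x dt = 0` for `j ≠ i`, and
`du^i_x - D_x(λ^i) u^i_x dt = 0`, where `D_x(λ^i) = ∑ k, u^k_x ∂_k λ^i` is the derivative of `λ^i`
at `u` in the direction `u_x`. -/
def mongeDistribution {n : ℕ} (lam : Fin n → (Fin n → ℝ) → ℝ) (i : Fin n) (z : Jet n) :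
    Submodule ℝ (Jet n) where
  carrier := {v |
    v.1 + lam i z.2.2.1 * v.2.1 = 0 ∧
    v.2.2.1 i = 0 ∧
    (∀ j, j ≠ i →
      v.2.2.1 j + (lam i z.2.2.1 - lam j z.2.2.1) * z.2.2.2 j * v.2.1 = 0) ∧
    v.2.2.2 i - fderiv ℝ (lam i) z.2.2.1 z.2.2.2 * z.2.2.2 i * v.2.1 = 0}
  zero_mem' := by simp
  add_mem' := by
    rintro v w ⟨h1, h2, h3, h4⟩ ⟨k1, k2, k3, k4⟩
    refine ⟨?_, ?_, fun j hj => ?_, ?_⟩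
    · simp only [Prod.fst_add, Prod.snd_add]; linear_combination h1 + k1
    · simp only [Prod.fst_add, Prod.snd_add, Pi.add_apply]; linear_combination h2 + k2
    · simp only [Prod.fst_add, Prod.snd_add, Pi.add_apply]
      linear_combination h3 j hj + k3 j hj
    · simp only [Prod.snd_add, Prod.fst_add, Pi.add_apply]; linear_combination h4 + k4
  smul_mem' := by
    rintro c v ⟨h1, h2, h3, h4⟩
    refine ⟨?_, ?_, fun j hj => ?_, ?_⟩
    · simp only [Prod.smul_fst, Prod.smul_snd, smul_eq_mul]; linear_combination c * h1
    · simp only [Prod.smul_fst, Prod.smul_snd, Pi.smul_apply, smul_eq_mul]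
      linear_combination c * h2
    · simp only [Prod.smul_fst, Prod.smul_snd, Pi.smul_apply, smul_eq_mul]
      linear_combination c * h3 j hj
    · simp only [Prod.smul_fst, Prod.smul_snd, Pi.smul_apply, smul_eq_mul]
      linear_combination c * h4

/-- `F` is a Riemann invariant on `G`: a first integral of the `i`-th Monge distribution. -/
def IsRiemannInvariant {n : ℕ} (r : WithTop ℕ∞) (lam : Fin n → (Fin n → ℝ) → ℝ) (i : Fin n)
    (G : Set (Jet n)) (F : Jet n → ℝ) : Prop :=
  ContDiffOn ℝ r F G ∧ ∀ z ∈ G, ∀ v ∈ mongeDistribution lam i z, fderiv ℝ F z v = 0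

/-- `F` is an extra Riemann invariant on `G`: a Riemann invariant of the `i`-th Monge distribution
that is functionally independent of the Riemann invariant `u^i`. -/
def IsExtraRiemannInvariant {n : ℕ} (r : WithTop ℕ∞) (lam : Fin n → (Fin n → ℝ) → ℝ) (i : Fin n)
    (G : Set (Jet n)) (F : Jet n → ℝ) : Prop :=
  IsRiemannInvariant r lam i G F ∧
    ∀ z ∈ G, LinearIndependent ℝ ![fderiv ℝ (fun y : Jet n => y.2.2.1 i) z, fderiv ℝ F z]

/-- The projection `(x, t, u, u_x) ↦ (x, t, u, u^i_x)`. -/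
def jetProj {n : ℕ} (i : Fin n) (z : Jet n) : ScalarJet n :=
  (z.1, z.2.1, z.2.2.1, z.2.2.2 i)

/-- `I = I(x, t, u, u^i_x)`, defined on the open set `D` lying over the domain `U` of the system,
is a second Riemann invariant of the `i`-th Monge distribution. -/
structure IsSecondRiemannInvariant {n : ℕ} (r : WithTop ℕ∞) (U : Set (Fin n → ℝ))
    (lam : Fin n → (Fin n → ℝ) → ℝ) (i : Fin n) (D : Set (ScalarJet n)) (I : ScalarJet n → ℝ) :
    Prop where
  isOpen : IsOpen D
  lies_over : ∀ y ∈ D, y.2.2.1 ∈ U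
  invariant : IsExtraRiemannInvariant r lam i (jetProj i ⁻¹' D) (fun z => I (jetProj i z))

/-- `P = P(x, t, u, s)`, defined and of class `C^r` on the open set `O`, is the result of solving
`I(x, t, u, q) = s` for `q`. -/
structure IsResolution {n : ℕ} (r : WithTop ℕ∞) (D : Set (ScalarJet n)) (I : ScalarJet n → ℝ)
    (O : Set (ScalarJet n)) (P : ScalarJet n → ℝ) : Prop where
  isOpen : IsOpen O
  contDiffOn : ContDiffOn ℝ r P O
  mem : ∀ y ∈ O, (y.1, y.2.1, y.2.2.1, P y) ∈ D
  solves : ∀ y ∈ O, I (y.1, y.2.1, y.2.2.1, P y) = y.2.2.2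

/-- The one-forms `du^i - P^i(x, t, u, φ_i(u^i)) (dx + λ^i(u) dt)` on the space of `(x, t, u)`. -/
noncomputable def resolvedSystem {n : ℕ} (lam : Fin n → (Fin n → ℝ) → ℝ)
    (P : Fin n → ScalarJet n → ℝ) (φ : Fin n → ℝ → ℝ) (i : Fin n) (z : Base n) :
    Base n →L[ℝ] ℝ :=
  let dx : Base n →L[ℝ] ℝ := fderiv ℝ (fun y : Base n => y.1) z
  let dt : Base n →L[ℝ] ℝ := fderiv ℝ (fun y : Base n => y.2.1) z
  let du : Base n →L[ℝ] ℝ := fderiv ℝ (fun y : Base n => y.2.2 i) z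
  du - P i (z.1, z.2.1, z.2.2, φ i (z.2.2 i)) • (dx + lam i z.2.2 • dt)

/-- The one-forms `du^i - P^i(x, t, u, φ_i(u^i)) (dx + λ^i(u) dt)` for `i ≠ m`, supplemented by
`du^m - u^m_x (dx + λ^m(u) dt)`, on the space of `(x, t, u, u^m_x)`. -/
noncomputable def partiallyResolvedSystem {n : ℕ} (m : Fin n) (lam : Fin n → (Fin n → ℝ) → ℝ)
    (P : Fin n → ScalarJet n → ℝ) (φ : Fin n → ℝ → ℝ) (i : Fin n) (z : ScalarJet n) :
    ScalarJet n →L[ℝ] ℝ :=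
  let dx : ScalarJet n →L[ℝ] ℝ := fderiv ℝ (fun y : ScalarJet n => y.1) z
  let dt : ScalarJet n →L[ℝ] ℝ := fderiv ℝ (fun y : ScalarJet n => y.2.1) z
  let du : ScalarJet n →L[ℝ] ℝ := fderiv ℝ (fun y : ScalarJet n => y.2.2.1 i) z
  let p : ℝ := if i = m then z.2.2.2 else P i (z.1, z.2.1, z.2.2.1, φ i (z.2.2.1 i))
  du - p • (dx + lam i z.2.2.1 • dt)

/-! ### Integral surfaces of two commuting vector fields. -/

section IntegralSurfaces

open Filter Topology Asymptotics

variable {E : Type*} [NormedAddCommGroup E] [NormedSpace ℝ E]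

/-! Write θ^i = du^i - p_i (dx + λ^i dt). A tangent vector satisfies du^j = p_j (dx + λ^j dt) for
all j, so for each i its (x, t, u)-part is a combination of e = (1, 0, p) and the Monge direction
m_i = (-λ^i, 1, (λ^j - λ^i) p_j). Since I^i is a first integral for every value of the u^j_x with j
≠ i, implicit differentiation of I^i(x, t, u, P^i) = s gives m_i(P^i) = p_i dλ^i(p). Substituting s
= φ_i(u^i) does no harm because du^i(m_i) = 0; see `fderiv_resolvedSlope_apply`. This equation says
exactly that dθ^i(e, m_i) = 0, hence that dθ^i vanishes on all pairs of tangent vectors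
(`symm_of_monge_equation`).

If this holds for all i, involution follows from θ([X, Y]) = -dθ(X, Y) for tangent X, Y. The frame
(1, 0, p), (0, 1, pλ) then even commutes, so composing the two flows produces the integral surface
(`hasIntegralManifoldAt_of_commute`).

If the m-th invariant is missing, p_m is the free coordinate u^m_x. The Monge equations for i ≠ m
hold for arbitrary u^m_x, so dθ^i still vanishes on tangent vectors. Only dθ^m remains, and it is
annihilated by m_m once this is lifted with du^m_x = u^m_x dλ^m(p), as in the Monge distribution
itself. This lift is the Cauchy characteristic. -/

/-- Quadratic estimate for the remainder of a first-order expansion on a convex set. -/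
theorem norm_sub_sub_le_of_lipschitzOnWith_deriv {F : Type*} [NormedAddCommGroup F]
    [NormedSpace ℝ F] {Y : E → F} {Y' : E → E →L[ℝ] F} {B : Set E} {M : NNReal}
    (hB : Convex ℝ B) (hY : ∀ z ∈ B, HasFDerivAt Y (Y' z) z) (hM : LipschitzOnWith M Y' B)
    {a b : E} (ha : a ∈ B) (hb : b ∈ B) :
    ‖Y b - Y a - Y' a (b - a)‖ ≤ M * ‖b - a‖ ^ 2 := by
  have hseg : segment ℝ a b ⊆ B := hB.segment_subset ha hb
  have key := Convex.norm_image_sub_le_of_norm_hasFDerivWithin_le' (φ := Y' a)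
    (C := M * ‖b - a‖) (fun z hz => (hY z (hseg hz)).hasFDerivWithinAt) (fun z hz => by
      have h1 := hM.norm_sub_le (hseg hz) ha
      have h2 : ‖z - a‖ ≤ ‖b - a‖ := by
        simpa [dist_eq_norm] using norm_sub_le_of_mem_segment hz
      exact h1.trans (by gcongr)) (convex_segment a b) (left_mem_segment ℝ a b)
      (right_mem_segment ℝ a b)
  calc _ ≤ _ := key
    _ = _ := by ring

/-- If `X` and `Y` commute, the flow of `Y` maps a solution curve of `X` to a curve whose velocity
is again given by `X`. -/
theorem hasDerivAt_flow_of_commute {X Y : E → E} {X' Y' : E → E →L[ℝ] E} {B : Set E}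
    {K M : NNReal} (hB : Convex ℝ B) (hX : ∀ z ∈ B, HasFDerivAt X (X' z) z)
    (hY : ∀ z ∈ B, HasFDerivAt Y (Y' z) z) (hK : ∀ z ∈ B, ‖Y' z‖ ≤ K)
    (hM : LipschitzOnWith M Y' B) (hcomm : ∀ z ∈ B, X' z (Y z) = Y' z (X z))
    {g : ℝ → ℝ → E} {x T L : ℝ} (hT : 0 ≤ T)
    (hgB : ∀ᶠ y in 𝓝 x, ∀ s ∈ Set.Icc 0 T, g y s ∈ B)
    (hg : ∀ᶠ y in 𝓝 x, ∀ s ∈ Set.Icc 0 T, HasDerivAt (g y) (Y (g y s)) s)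
    (hL : ∀ᶠ y in 𝓝 x, ∀ s ∈ Set.Icc 0 T, ‖g y s - g x s‖ ≤ L * |y - x|)
    (h0 : HasDerivAt (fun y => g y 0) (X (g x 0)) x) :
    HasDerivAt (fun y => g y T) (X (g x T)) x := by
  -- The error of the first-order prediction g x s + (y - x) X(g x s). The claim is that it is o(y -
  -- x) at s = T, given that it is so at s = 0.
  set w : ℝ → ℝ → E := fun y s => g y s - g x s - (y - x) • X (g x s) with hw
  have hxB := hgB.self_of_nhds
  have hxg := hg.self_of_nhds
  -- K may be 0, and the closed form of the Gronwall bound divides by its rate; hence the rate K +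
  -- 1.
  have hK' : (K : ℝ) + 1 ≠ 0 := by positivity
  have bound : ∀ᶠ y in 𝓝 x, ‖w y T‖ ≤ Real.exp ((K + 1) * T) * ‖w y 0‖ +
      (M * L ^ 2 / (K + 1) * (Real.exp ((K + 1) * T) - 1)) * (y - x) ^ 2 := by
    filter_upwards [hgB, hg, hL] with y hyB hyg hyL
    have hder : ∀ s ∈ Set.Icc 0 T, HasDerivAt (w y)
        (Y (g y s) - Y (g x s) - (y - x) • X' (g x s) (Y (g x s))) s := fun s hs =>
      ((hyg s hs).sub (hxg s hs)).sub
        (((hX _ (hxB s hs)).comp_hasDerivAt s (hxg s hs)).const_smul (y - x))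
    have := norm_le_gronwallBound_of_norm_deriv_right_le (f := w y) (δ := ‖w y 0‖)
      (K := K + 1) (ε := M * (L * |y - x|) ^ 2) (a := 0) (b := T)
      (fun s hs => (hder s hs).continuousAt.continuousWithinAt)
      (fun s hs => (hder s (Set.Ico_subset_Icc_self hs)).hasDerivWithinAt) le_rfl
      (fun s hs => by
        have hs := Set.Ico_subset_Icc_self hs
        -- Commutation makes s ↦ X(g x s) a solution of the equation of Y linearised along g x, so w
        -- solves that linear equation up to a remainder quadratic in y - x.
        have e : Y (g y s) - Y (g x s) - (y - x) • X' (g x s) (Y (g x s)) =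
            Y' (g x s) (w y s) + (Y (g y s) - Y (g x s) - Y' (g x s) (g y s - g x s)) := by
          simp only [hw, map_sub, map_smul, hcomm _ (hxB s hs)]
          abel
        rw [e]
        refine (norm_add_le _ _).trans (add_le_add ?_ ?_)
        · refine ((Y' (g x s)).le_opNorm _).trans ?_
          gcongr
          linarith [hK _ (hxB s hs)]
        · refine (norm_sub_sub_le_of_lipschitzOnWith_deriv hB hY hM (hxB s hs) (hyB s hs)).trans ?_
          gcongr
          exact hyL s hs)
      T ⟨hT, le_rfl⟩
    rw [gronwallBound_of_K_ne_0 hK', sub_zero, mul_pow, sq_abs] at this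
    refine this.trans (le_of_eq ?_)
    ring
  rw [hasDerivAt_iff_isLittleO] at h0 ⊢
  have hsq : (fun y => (y - x) ^ 2) =o[𝓝 x] fun y => y - x := by
    have : Tendsto (fun y : ℝ => y - x) (𝓝 x) (𝓝 0) := by
      have : Continuous fun y : ℝ => y - x := by fun_prop
      simpa using this.tendsto x
    have := (Asymptotics.isLittleO_pow_id (𝕜 := ℝ) (n := 2) one_lt_two).comp_tendsto this
    simpa [Function.comp_def] using this
  have hsum := (h0.norm_left.const_mul_left (Real.exp ((K + 1) * T))).add
    (hsq.const_mul_left (M * L ^ 2 / (K + 1) * (Real.exp ((K + 1) * T) - 1)))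
  refine Asymptotics.IsBigO.trans_isLittleO (Asymptotics.IsBigO.of_bound 1 ?_) hsum
  filter_upwards [bound] with y hy
  rw [one_mul]
  exact hy.trans (le_abs_self _)

/-- A solution of the total differential equation `Df = A(f)` with smooth `A` is smooth. -/
theorem contDiffOn_infty_of_hasFDerivAt_comp {F : Type*} [NormedAddCommGroup F] [NormedSpace ℝ F]
    {f : F → E} {A : E → F →L[ℝ] E} {V : Set F} {W : Set E} (hV : IsOpen V)
    (hA : ContDiffOn ℝ ∞ A W) (hf : Set.MapsTo f V W)
    (hd : ∀ y ∈ V, HasFDerivAt f (A (f y)) y) : ContDiffOn ℝ ∞ f V := by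
  rw [contDiffOn_infty]
  intro k
  -- Bootstrapping: if f is C^k, then so is Df = A(f), and f is C^(k+1).
  induction k with
  | zero =>
    exact contDiffOn_zero.2 fun y hy => (hd y hy).continuousAt.continuousWithinAt
  | succ k ih =>
    push_cast
    rw [contDiffOn_succ_iff_fderiv_of_isOpen hV]
    refine ⟨fun y hy => (hd y hy).differentiableAt.differentiableWithinAt, by simp, ?_⟩
    exact ((hA.of_le (by exact_mod_cast le_top)).comp ih hf).congr fun y hy => (hd y hy).fderiv

/-- Two commuting smooth vector fields have a common local two-parameter integral surface. -/
theorem exists_integralSurface_of_commute [CompleteSpace E] {X Y : E → E} {W : Set E}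
    (hW : IsOpen W) (hX : ContDiffOn ℝ ∞ X W) (hY : ContDiffOn ℝ ∞ Y W)
    (hcomm : ∀ z ∈ W, fderiv ℝ X z (Y z) = fderiv ℝ Y z (X z)) {z₀ : E} (hz₀ : z₀ ∈ W) :
    ∃ δ > (0 : ℝ), ∃ g : ℝ → ℝ → E, g 0 0 = z₀ ∧ ∀ x t, |x| < δ → |t| < δ →
      g x t ∈ W ∧ ContinuousAt (fun p : ℝ × ℝ => g p.1 p.2) (x, t) ∧
      HasDerivAt (fun y => g y t) (X (g x t)) x ∧ HasDerivAt (g x) (Y (g x t)) t := by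
  have hXz := hX.contDiffAt (hW.mem_nhds hz₀)
  have hYz := hY.contDiffAt (hW.mem_nhds hz₀)
  have hYd : ContDiffAt ℝ 1 (fderiv ℝ Y) z₀ :=
    (hY.fderiv_of_isOpen hW (m := ∞) le_rfl).contDiffAt (hW.mem_nhds hz₀) |>.of_le (by simp)
  -- The surface will be g x t = α (h x) t, with α the local flow of Y and h the integral curve of X
  -- through z₀. Its t-derivative is clear; its x-derivative is X at t = 0 and is carried to other t
  -- by commutation.
  obtain ⟨ε₁, hε₁, _, r, _, _, hr, hpl⟩ :=
    IsPicardLindelof.of_contDiffAt_one (hYz.of_le (by simp))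
  obtain ⟨α, hα, L, hL⟩ :=
    (hpl 0).exists_forall_mem_closedBall_eq_hasDerivWithinAt_lipschitzOnWith
  simp only [zero_sub, zero_add] at hα hL
  have hαc : ContinuousOn (Function.uncurry α) (Metric.closedBall z₀ r ×ˢ Set.Icc (-ε₁) ε₁) :=
    continuousOn_prod_of_continuousOn_lipschitzOnWith _ L
      (fun x hx => HasDerivWithinAt.continuousOn (hα x hx).2) hL
  obtain ⟨h, hh0, ε₂, hε₂, hh⟩ :=
    (hXz.of_le (by simp)).exists_forall_mem_closedBall_exists_eq_forall_mem_Ioo_hasDerivAt₀ 0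
  simp only [zero_sub, zero_add] at hh
  obtain ⟨M, s, hs, hM⟩ := hYd.exists_lipschitzOnWith
  have hnear : ∀ᶠ z in 𝓝 z₀, z ∈ W ∧ z ∈ s ∧ ‖fderiv ℝ Y z‖ ≤ ‖fderiv ℝ Y z₀‖₊ + 1 := by
    filter_upwards [hW.mem_nhds hz₀, hs,
      hYd.continuousAt.norm.eventually_lt continuousAt_const (lt_add_one _)] with z h1 h2 h3
    exact ⟨h1, h2, h3.le⟩
  obtain ⟨ρ, hρ, hball⟩ := Metric.eventually_nhds_iff_ball.1 hnear
  have hgc : ∀ x t, |x| < ε₂ → |t| < ε₁ → h x ∈ Metric.ball z₀ r →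
      ContinuousAt (fun p : ℝ × ℝ => α (h p.1) p.2) (x, t) := by
    intro x t hx ht hxr
    have h1 : ContinuousAt (fun p : ℝ × ℝ => (h p.1, p.2)) (x, t) :=
      ((hh x (abs_lt.1 hx)).continuousAt.comp (x := (x, t)) continuousAt_fst).prodMk
        continuousAt_snd
    have h2 : ContinuousAt (Function.uncurry α) (h x, t) :=
      hαc.continuousAt (prod_mem_nhds (mem_of_superset (Metric.isOpen_ball.mem_nhds hxr)
        Metric.ball_subset_closedBall) (Icc_mem_nhds (abs_lt.1 ht).1 (abs_lt.1 ht).2))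
    exact ContinuousAt.comp (x := (x, t)) h2 h1
  have h00 : α (h 0) 0 = z₀ := by
    rw [hh0]; exact (hα z₀ (Metric.mem_closedBall_self r.2)).1
  have hnear0 : ∀ᶠ p in 𝓝 ((0 : ℝ), (0 : ℝ)), |p.1| < ε₂ ∧ |p.2| < ε₁ ∧
      h p.1 ∈ Metric.ball z₀ r ∧ α (h p.1) p.2 ∈ Metric.ball z₀ ρ := by
    have c1 : Continuous fun p : ℝ × ℝ => |p.1| := by fun_prop
    have c2 : Continuous fun p : ℝ × ℝ => |p.2| := by fun_prop
    have c3 : ContinuousAt (fun p : ℝ × ℝ => h p.1) (0, 0) :=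
      (hh 0 ⟨by linarith, hε₂⟩).continuousAt.comp (x := ((0 : ℝ), (0 : ℝ))) continuousAt_fst
    have c4 := hgc 0 0 (by simpa) (by simpa) (by rw [hh0]; exact Metric.mem_ball_self hr)
    refine (c1.continuousAt.eventually_lt continuousAt_const (by simpa)).and
      ((c2.continuousAt.eventually_lt continuousAt_const (by simpa)).and
        ((c3.eventually_mem (Metric.isOpen_ball.mem_nhds ?_)).and
          (c4.eventually_mem (Metric.isOpen_ball.mem_nhds ?_))))
    · simpa [hh0] using hr
    · simpa [h00] using hρ
  obtain ⟨δ, hδ, hδs⟩ := Metric.eventually_nhds_iff_ball.1 hnear0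
  have hgood : ∀ x t, |x| < δ → |t| < δ → |x| < ε₂ ∧ |t| < ε₁ ∧
      h x ∈ Metric.ball z₀ r ∧ α (h x) t ∈ Metric.ball z₀ ρ := fun x t hx ht =>
    hδs (x, t) (by simpa [Metric.mem_ball, Prod.dist_eq] using ⟨hx, ht⟩)
  have hder : ∀ x t, |x| < δ → |t| < δ → HasDerivAt (α (h x)) (Y (α (h x) t)) t := by
    intro x t hx ht
    obtain ⟨-, ht', hr', -⟩ := hgood x t hx ht
    have ht'' := abs_lt.1 ht'
    exact ((hα (h x) (Metric.ball_subset_closedBall hr')).2 t ⟨ht''.1.le, ht''.2.le⟩).hasDerivAt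
      (Icc_mem_nhds ht''.1 ht''.2)
  refine ⟨δ, hδ, fun x t => α (h x) t, h00, fun x t hx ht => ?_⟩
  obtain ⟨hx', ht', hr', hρ'⟩ := hgood x t hx ht
  refine ⟨(hball _ hρ').1, hgc x t hx' ht' hr', ?_, hder x t hx ht⟩
  have hx0 : ∀ᶠ y in 𝓝 x, |y| < δ :=
    (continuous_abs.continuousAt).eventually_lt continuousAt_const hx
  have hxd := hh x (abs_lt.1 hx')
  obtain ⟨C, hC⟩ := hxd.isBigO_sub.bound
  -- The flow is L-Lipschitz in its initial value, and h is differentiable at x.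
  have hlip : ∀ᶠ y in 𝓝 x, ∀ s, |s| < δ → ‖α (h y) s - α (h x) s‖ ≤ L * C * |y - x| := by
    filter_upwards [hx0, hC] with y hy hyC s hs
    obtain ⟨-, hs', hyr, -⟩ := hgood y s hy hs
    have hs'' := abs_lt.1 hs'
    refine ((hL s ⟨hs''.1.le, hs''.2.le⟩).norm_sub_le (Metric.ball_subset_closedBall hyr)
      (Metric.ball_subset_closedBall hr')).trans ?_
    rw [mul_assoc]
    gcongr
    simpa using hyC
  have h0 : HasDerivAt (fun y => α (h y) 0) (X (α (h x) 0)) x := by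
    rw [(hα _ (Metric.ball_subset_closedBall hr')).1]
    refine hxd.congr_of_eventuallyEq ?_
    filter_upwards [hx0] with y hy
    obtain ⟨-, -, hyr, -⟩ := hgood y t hy ht
    exact (hα _ (Metric.ball_subset_closedBall hyr)).1
  have hXB : ∀ z ∈ Metric.ball z₀ ρ, HasFDerivAt X (fderiv ℝ X z) z := fun z hz =>
    (hX.differentiableOn (by simp)).hasFDerivAt (hW.mem_nhds (hball z hz).1)
  have hYB : ∀ z ∈ Metric.ball z₀ ρ, HasFDerivAt Y (fderiv ℝ Y z) z := fun z hz =>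
    (hY.differentiableOn (by simp)).hasFDerivAt (hW.mem_nhds (hball z hz).1)
  have hKB : ∀ z ∈ Metric.ball z₀ ρ, ‖fderiv ℝ Y z‖ ≤ ((‖fderiv ℝ Y z₀‖₊ + 1 : NNReal) : ℝ) :=
    fun z hz => by simpa using (hball z hz).2.2
  have hMB : LipschitzOnWith M (fderiv ℝ Y) (Metric.ball z₀ ρ) :=
    hM.mono fun z hz => (hball z hz).2.1
  rcases le_total 0 t with h0t | h0t
  · have hst : ∀ s ∈ Set.Icc 0 t, |s| < δ := fun s hs => by
      rw [abs_of_nonneg hs.1]; exact (hs.2.trans (le_abs_self t)).trans_lt ht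
    exact hasDerivAt_flow_of_commute (convex_ball z₀ ρ) hXB hYB hKB hMB
      (fun z hz => hcomm z (hball z hz).1) h0t
      (hx0.mono fun y hy s hs => (hgood y s hy (hst s hs)).2.2.2)
      (hx0.mono fun y hy s hs => hder y s hy (hst s hs))
      (hlip.mono fun y hy s hs => hy s (hst s hs)) h0
  -- Negative times are positive times for the flow of -Y, which also commutes with X.
  · have hst : ∀ s ∈ Set.Icc 0 (-t), |-s| < δ := fun s hs => by
      rw [abs_neg, abs_of_nonneg hs.1]; exact (hs.2.trans (neg_le_abs t)).trans_lt ht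
    have := hasDerivAt_flow_of_commute (X := X) (Y := fun z => -Y z)
      (Y' := fun z => -fderiv ℝ Y z) (M := M) (g := fun y s => α (h y) (-s)) (x := x)
      (convex_ball z₀ ρ) hXB (fun z hz => (hYB z hz).neg)
      (fun z hz => by rw [norm_neg]; exact hKB z hz)
      (LipschitzOnWith.of_dist_le_mul fun a ha b hb => by
        rw [dist_neg_neg]; exact hMB.dist_le_mul a ha b hb)
      (fun z hz => by simp [hcomm z (hball z hz).1]) (neg_nonneg.2 h0t)
      (hx0.mono fun y hy s hs => (hgood y (-s) hy (hst s hs)).2.2.2)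
      (hx0.mono fun y hy s hs => by
        have := (hder y (-s) hy (hst s hs)).scomp s (hasDerivAt_neg s)
        simpa [Function.comp_def] using this)
      (hlip.mono fun y hy s hs => hy (-s) (hst s hs)) (by simpa using h0)
    simpa using this

/-- A distribution spanned by two commuting, linearly independent smooth vector fields has an
integral manifold through every point. -/
theorem hasIntegralManifoldAt_of_commute [CompleteSpace E] {X Y : E → E} {W : Set E}
    {𝒟 : E → Submodule ℝ E} (hW : IsOpen W) (hX : ContDiffOn ℝ ∞ X W) (hY : ContDiffOn ℝ ∞ Y W)
    (hcomm : ∀ z ∈ W, fderiv ℝ X z (Y z) = fderiv ℝ Y z (X z))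
    (hli : ∀ z ∈ W, ∀ a b : ℝ, a • X z + b • Y z = 0 → a = 0 ∧ b = 0)
    (h𝒟 : ∀ z ∈ W, ∀ v, v ∈ 𝒟 z ↔ ∃ a b : ℝ, a • X z + b • Y z = v) {z₀ : E} (hz₀ : z₀ ∈ W) :
    HasIntegralManifoldAt 𝒟 W z₀ := by
  obtain ⟨δ, hδ, g, hg0, hg⟩ := exists_integralSurface_of_commute hW hX hY hcomm hz₀
  set V : Set (Fin 2 → ℝ) := {y | |y 0| < δ ∧ |y 1| < δ} with hVdef
  have hV : IsOpen V :=
    (isOpen_lt (f := fun y : Fin 2 → ℝ => |y 0|) (by fun_prop) continuous_const).inter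
      (isOpen_lt (f := fun y : Fin 2 → ℝ => |y 1|) (by fun_prop) continuous_const)
  let pr (i : Fin 2) : (Fin 2 → ℝ) →L[ℝ] ℝ := ContinuousLinearMap.proj i
  let A : E → (Fin 2 → ℝ) →L[ℝ] E := fun z => (pr 0).smulRight (X z) + (pr 1).smulRight (Y z)
  have hA : ContDiffOn ℝ ∞ A W :=
    ((ContinuousLinearMap.smulRightL ℝ (Fin 2 → ℝ) E (pr 0)).contDiff.comp_contDiffOn hX).add
      ((ContinuousLinearMap.smulRightL ℝ (Fin 2 → ℝ) E (pr 1)).contDiff.comp_contDiffOn hY)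
  have hAv : ∀ z v, A z v = v 0 • X z + v 1 • Y z := fun z v => rfl
  have hmaps : Set.MapsTo (fun y => g (y 0) (y 1)) V W := fun y hy => (hg _ _ hy.1 hy.2).1
  -- The partial derivatives X(g), Y(g) exist nearby and are continuous, so g is totally
  -- differentiable.
  have hd : ∀ y ∈ V, HasFDerivAt (fun y : Fin 2 → ℝ => g (y 0) (y 1)) (A (g (y 0) (y 1))) y := by
    intro y hy
    have hev : ∀ᶠ p in 𝓝 (y 0, y 1), |p.1| < δ ∧ |p.2| < δ :=
      ((continuous_abs.comp continuous_fst).continuousAt.eventually_lt continuousAt_const hy.1).and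
        ((continuous_abs.comp continuous_snd).continuousAt.eventually_lt continuousAt_const hy.2)
    obtain ⟨hgW, hgc, -, -⟩ := hg _ _ hy.1 hy.2
    have cX : ContinuousAt (fun p : ℝ × ℝ => X (g p.1 p.2)) (y 0, y 1) :=
      ContinuousAt.comp (x := (y 0, y 1)) (g := X)
        (hX.continuousOn.continuousAt (hW.mem_nhds hgW)) hgc
    have cY : ContinuousAt (fun p : ℝ × ℝ => Y (g p.1 p.2)) (y 0, y 1) :=
      ContinuousAt.comp (x := (y 0, y 1)) (g := Y)
        (hY.continuousOn.continuousAt (hW.mem_nhds hgW)) hgc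
    let R : E →L[ℝ] ℝ →L[ℝ] E := ContinuousLinearMap.smulRightL ℝ ℝ E (ContinuousLinearMap.id ℝ ℝ)
    have := hasStrictFDerivAt_uncurry_coprod (𝕜 := ℝ) (u := (y 0, y 1)) (f := g)
      (f₁ := fun x t => R (X (g x t))) (f₂ := fun x t => R (Y (g x t)))
      (hev.mono fun p hp => (hg _ _ hp.1 hp.2).2.2.1.hasFDerivAt)
      (hev.mono fun p hp => (hg _ _ hp.1 hp.2).2.2.2.hasFDerivAt)
      (R.continuous.continuousAt.comp cX) (R.continuous.continuousAt.comp cY)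
    exact this.hasFDerivAt.comp (f := fun y : Fin 2 → ℝ => (y 0, y 1)) y
      ((pr 0).hasFDerivAt.prodMk (pr 1).hasFDerivAt)
  refine ⟨2, V, fun y => g (y 0) (y 1), hV, by simp [hVdef, hδ], hg0,
    contDiffOn_infty_of_hasFDerivAt_comp hV hA hmaps hd, hmaps, fun y hy => ?_⟩
  rw [(hd y hy).fderiv]
  have hz := hmaps hy
  constructor
  · refine (injective_iff_map_eq_zero _).2 fun v hv => ?_
    obtain ⟨h0, h1⟩ := hli _ hz _ _ ((hAv _ v).symm.trans hv)
    ext i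
    fin_cases i
    · exact h0
    · exact h1
  · ext v
    rw [h𝒟 _ hz]
    constructor
    · rintro ⟨c, rfl⟩
      exact ⟨c 0, c 1, rfl⟩
    · rintro ⟨a, b, rfl⟩
      exact ⟨![a, b], by simp [hAv]⟩

end IntegralSurfaces

/-! ### Brackets of tangent fields and exterior derivatives of the forms. -/

section PfaffianSystems

open Filter Topology

variable {E : Type*} [NormedAddCommGroup E] [NormedSpace ℝ E]

theorem mem_pfaffDistribution {ι : Type*} {θ : ι → E → (E →L[ℝ] ℝ)} {z v : E} :
    v ∈ pfaffDistribution θ z ↔ ∀ i, θ i z v = 0 := by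
  simp [pfaffDistribution]

/-- Differentiating the identity `θ(X) = 0`. -/
theorem apply_fderiv_of_eventually_apply_eq_zero {θ : E → (E →L[ℝ] ℝ)} {X : E → E} {z : E}
    (hθ : DifferentiableAt ℝ θ z) (hX : DifferentiableAt ℝ X z) (h : ∀ᶠ y in 𝓝 z, θ y (X y) = 0)
    (w : E) : θ z (fderiv ℝ X z w) = -fderiv ℝ θ z w (X z) := by
  have h1 := hθ.hasFDerivAt.clm_apply hX.hasFDerivAt
  have h2 : HasFDerivAt (fun y => θ y (X y)) (0 : E →L[ℝ] ℝ) z :=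
    (hasFDerivAt_const (0 : ℝ) z).congr_of_eventuallyEq h
  have h3 := DFunLike.congr_fun (h1.unique h2) w
  simp only [add_apply, ContinuousLinearMap.comp_apply,
    ContinuousLinearMap.flip_apply, zero_apply] at h3
  linarith

/-- If `dθ(X, Y)` vanishes at a point for two fields tangent to the distribution, then their
bracket is tangent to the distribution at that point. -/
theorem lieBracket_mem_pfaffDistribution {ι : Type*} {θ : ι → E → (E →L[ℝ] ℝ)} {V : Set E}
    {X Y : E → E} {z : E} (hV : V ∈ 𝓝 z) (hθ : ∀ i, DifferentiableAt ℝ (θ i) z)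
    (hX : DifferentiableAt ℝ X z) (hY : DifferentiableAt ℝ Y z)
    (hXt : ∀ y ∈ V, X y ∈ pfaffDistribution θ y) (hYt : ∀ y ∈ V, Y y ∈ pfaffDistribution θ y)
    (hsymm : ∀ i, fderiv ℝ (θ i) z (X z) (Y z) = fderiv ℝ (θ i) z (Y z) (X z)) :
    VectorField.lieBracket ℝ X Y z ∈ pfaffDistribution θ z := by
  refine mem_pfaffDistribution.2 fun i => ?_
  have hX0 : ∀ᶠ y in 𝓝 z, θ i y (X y) = 0 :=
    mem_of_superset hV fun y hy => mem_pfaffDistribution.1 (hXt y hy) i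
  have hY0 : ∀ᶠ y in 𝓝 z, θ i y (Y y) = 0 :=
    mem_of_superset hV fun y hy => mem_pfaffDistribution.1 (hYt y hy) i
  -- θ([X, Y]) = θ(DY X) - θ(DX Y) = -dθ(X, Y).
  rw [VectorField.lieBracket_eq, map_sub,
    apply_fderiv_of_eventually_apply_eq_zero (hθ i) hY hY0,
    apply_fderiv_of_eventually_apply_eq_zero (hθ i) hX hX0, hsymm i, sub_self]

/-- The derivative of a one-form `du - p (dx + l dt)`. -/
theorem hasFDerivAt_slopeForm (du dx dt : E →L[ℝ] ℝ) {p l : E → ℝ} {p' l' : E →L[ℝ] ℝ} {z : E}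
    (hp : HasFDerivAt p p' z) (hl : HasFDerivAt l l' z) :
    HasFDerivAt (fun y => du - p y • (dx + l y • dt))
      (-(p z • l'.smulRight dt + p'.smulRight (dx + l z • dt))) z := by
  exact (hp.smul ((hl.smul_const dt).const_add dx)).const_sub du

theorem differentiableAt_slopeForm (du dx dt : E →L[ℝ] ℝ) {p l : E → ℝ} {z : E}
    (hp : DifferentiableAt ℝ p z) (hl : DifferentiableAt ℝ l z) :
    DifferentiableAt ℝ (fun y => du - p y • (dx + l y • dt)) z :=
  (hasFDerivAt_slopeForm du dx dt hp.hasFDerivAt hl.hasFDerivAt).differentiableAt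

theorem fderiv_slopeForm_apply (du dx dt : E →L[ℝ] ℝ) {p l : E → ℝ} {z : E}
    (hp : DifferentiableAt ℝ p z) (hl : DifferentiableAt ℝ l z) (v w : E) :
    fderiv ℝ (fun y => du - p y • (dx + l y • dt)) z v w =
      -(fderiv ℝ p z v * (dx w + l z * dt w) + p z * fderiv ℝ l z v * dt w) := by
  rw [(hasFDerivAt_slopeForm du dx dt hp.hasFDerivAt hl.hasFDerivAt).fderiv]
  simp
  ring

end PfaffianSystems

/-! ### The Monge equation for resolved slopes. -/

section MongeSystems

open Filter Topology

variable {n : ℕ} {r : WithTop ℕ∞}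

/-- The slope `P(x, t, u, φ(u^i))`. -/
def resolvedSlope (i : Fin n) (P : ScalarJet n → ℝ) (φ : ℝ → ℝ) (z : Base n) : ℝ :=
  P (z.1, z.2.1, z.2.2, φ (z.2.2 i))

theorem contDiffAt_resolvedSlope {i : Fin n} {O : Set (ScalarJet n)} {P : ScalarJet n → ℝ}
    {J : Set ℝ} {φ : ℝ → ℝ} {z : Base n} (hO : IsOpen O) (hP : ContDiffOn ℝ r P O)
    (hJ : IsOpen J) (hφ : ContDiffOn ℝ r φ J) (hzJ : z.2.2 i ∈ J)
    (hzO : (z.1, z.2.1, z.2.2, φ (z.2.2 i)) ∈ O) : ContDiffAt ℝ r (resolvedSlope i P φ) z := by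
  have hφz : ContDiffAt ℝ r (fun y : Base n => φ (y.2.2 i)) z :=
    (hφ.contDiffAt (hJ.mem_nhds hzJ)).comp z (by fun_prop)
  refine ContDiffAt.comp z (g := P) (f := fun y : Base n => (y.1, y.2.1, y.2.2, φ (y.2.2 i)))
    (hP.contDiffAt (hO.mem_nhds hzO)) ?_
  exact contDiffAt_fst.prodMk (contDiffAt_snd.fst.prodMk (contDiffAt_snd.snd.prodMk hφz))

/-- Regularity is assumed only for the pullback of I to the jet space; the section with all u^k_x
equal to s recovers I from it. -/
theorem IsSecondRiemannInvariant.contDiffOn {U : Set (Fin n → ℝ)} {lam : Fin n → (Fin n → ℝ) → ℝ}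
    {i : Fin n} {D : Set (ScalarJet n)} {I : ScalarJet n → ℝ}
    (hI : IsSecondRiemannInvariant r U lam i D I) : ContDiffOn ℝ r I D := by
  have hs : ContDiff ℝ r
      (fun y : ScalarJet n => ((y.1, y.2.1, y.2.2.1, fun _ => y.2.2.2) : Jet n)) := by
    fun_prop
  exact (hI.invariant.1.1.comp hs.contDiffOn (s := D) fun y hy => hy)

/-- The equation that a second Riemann invariant satisfies along the Monge direction. -/
theorem IsSecondRiemannInvariant.fderiv_apply_eq_zero (hr : 1 ≤ r) {U : Set (Fin n → ℝ)}
    {lam : Fin n → (Fin n → ℝ) → ℝ} {i : Fin n} {D : Set (ScalarJet n)} {I : ScalarJet n → ℝ}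
    (hI : IsSecondRiemannInvariant r U lam i D I) (x t : ℝ) (u p : Fin n → ℝ)
    (hD : (x, t, u, p i) ∈ D) :
    fderiv ℝ I (x, t, u, p i) (-lam i u, 1, fun j => (lam j u - lam i u) * p j,
      p i * fderiv ℝ (lam i) u p) = 0 := by
  have hId : DifferentiableAt ℝ I (x, t, u, p i) :=
    (hI.contDiffOn.contDiffAt (hI.isOpen.mem_nhds hD)).differentiableAt (by
      rintro rfl; simp at hr)
  let L : Jet n →L[ℝ] ScalarJet n :=
    (ContinuousLinearMap.fst ℝ _ _).prod (((ContinuousLinearMap.fst ℝ _ _).comp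
      (ContinuousLinearMap.snd ℝ _ _)).prod ((((ContinuousLinearMap.fst ℝ _ _).comp
      (ContinuousLinearMap.snd ℝ _ _)).comp (ContinuousLinearMap.snd ℝ _ _)).prod
      ((ContinuousLinearMap.proj i).comp (((ContinuousLinearMap.snd ℝ _ _).comp
      (ContinuousLinearMap.snd ℝ _ _)).comp (ContinuousLinearMap.snd ℝ _ _)))))
  have hL : HasFDerivAt (jetProj i) L ((x, t, u, p) : Jet n) := L.hasFDerivAt
  have hc := HasFDerivAt.comp ((x, t, u, p) : Jet n) (g := I) hId.hasFDerivAt hL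
  -- The Monge distribution constrains only the i-th entry of du_x, and `jetProj i` forgets the
  -- others, so a constant vector serves.
  have h0 := hI.invariant.1.2 (x, t, u, p) hD
    (-lam i u, 1, fun j => (lam j u - lam i u) * p j, fun _ => p i * fderiv ℝ (lam i) u p)
    ⟨by simp, by simp, fun j _ => by simp only; ring, by simp only; ring⟩
  rw [show (fun z => I (jetProj i z)) = I ∘ jetProj i from rfl, hc.fderiv] at h0
  exact h0

/-- The equation satisfied by the resolution of a second Riemann invariant along the Monge
direction, after substitution of `s = φ(u^i)`. -/
theorem fderiv_resolvedSlope_apply (hr : 1 ≤ r) {U : Set (Fin n → ℝ)}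
    {lam : Fin n → (Fin n → ℝ) → ℝ} {i : Fin n} {D O : Set (ScalarJet n)} {I P : ScalarJet n → ℝ}
    {φ : ℝ → ℝ} {z : Base n} (hI : IsSecondRiemannInvariant r U lam i D I)
    (hP : IsResolution r D I O P) (hφ : DifferentiableAt ℝ φ (z.2.2 i))
    (hz : (z.1, z.2.1, z.2.2, φ (z.2.2 i)) ∈ O) (p : Fin n → ℝ)
    (hp : p i = resolvedSlope i P φ z) :
    fderiv ℝ (resolvedSlope i P φ) z
        (-lam i z.2.2, 1, fun j => (lam j z.2.2 - lam i z.2.2) * p j) =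
      p i * fderiv ℝ (lam i) z.2.2 p := by
  have hr0 : r ≠ 0 := by rintro rfl; simp at hr
  obtain ⟨x, t, u⟩ := z
  simp only at hz hφ ⊢
  set τ : ScalarJet n := (x, t, u, φ (u i)) with hτ
  have hpτ : P τ = p i := hp.symm
  have hD : (x, t, u, p i) ∈ D := by rw [← hpτ]; exact hP.mem τ hz
  have hId : DifferentiableAt ℝ I (x, t, u, p i) :=
    (hI.contDiffOn.contDiffAt (hI.isOpen.mem_nhds hD)).differentiableAt hr0
  have hPd : DifferentiableAt ℝ P τ :=
    (hP.contDiffOn.contDiffAt (hP.isOpen.mem_nhds hz)).differentiableAt hr0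
  have hsolve : ∀ v : ScalarJet n,
      fderiv ℝ I (x, t, u, p i) (v.1, v.2.1, v.2.2.1, fderiv ℝ P τ v) = v.2.2.2 := by
    intro v
    have e1 : HasFDerivAt (fun y : ScalarJet n => y.2.1) _ τ :=
      (hasFDerivAt_snd (𝕜 := ℝ) (p := τ)).fst
    have e2 : HasFDerivAt (fun y : ScalarJet n => y.2.2.1) _ τ :=
      (hasFDerivAt_snd (𝕜 := ℝ) (p := τ)).snd.fst
    have h1 : HasFDerivAt (fun y : ScalarJet n => ((y.1, y.2.1, y.2.2.1, P y) : ScalarJet n)) _ τ :=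
      hasFDerivAt_fst.prodMk (e1.prodMk (e2.prodMk hPd.hasFDerivAt))
    have hId' : HasFDerivAt I (fderiv ℝ I (x, t, u, p i)) (τ.1, τ.2.1, τ.2.2.1, P τ) := by
      rw [hpτ]; exact hId.hasFDerivAt
    have h2 := HasFDerivAt.comp τ hId' h1
    have h3 : HasFDerivAt (fun y : ScalarJet n => y.2.2.2) _ τ :=
      (hasFDerivAt_snd (𝕜 := ℝ) (p := τ)).snd.snd
    have h4 := h2.unique (h3.congr_of_eventuallyEq
      (mem_of_superset (hP.isOpen.mem_nhds hz) fun y hy => hP.solves y hy))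
    exact DFunLike.congr_fun h4 v
  -- Along du^i = 0 the argument φ(u^i) is stationary, so φ' does not enter.
  have hchain : ∀ v : Base n, v.2.2 i = 0 →
      fderiv ℝ (resolvedSlope i P φ) (x, t, u) v = fderiv ℝ P τ (v.1, v.2.1, v.2.2, 0) := by
    intro v hv
    have e1 : HasFDerivAt (fun y : Base n => y.2.1) _ (x, t, u) :=
      (hasFDerivAt_snd (𝕜 := ℝ) (p := ((x, t, u) : Base n))).fst
    have e2 : HasFDerivAt (fun y : Base n => y.2.2) _ (x, t, u) :=
      (hasFDerivAt_snd (𝕜 := ℝ) (p := ((x, t, u) : Base n))).snd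
    have h0 : HasFDerivAt (fun y : Base n => φ (y.2.2 i)) _ (x, t, u) :=
      HasDerivAt.comp_hasFDerivAt (h₂ := φ) (f := fun y : Base n => y.2.2 i) (x, t, u)
        hφ.hasDerivAt (hasFDerivAt_pi'.1 e2 i)
    have h1 : HasFDerivAt
        (fun y : Base n => ((y.1, y.2.1, y.2.2, φ (y.2.2 i)) : ScalarJet n)) _ (x, t, u) :=
      hasFDerivAt_fst.prodMk (e1.prodMk (e2.prodMk h0))
    have h2 : HasFDerivAt (resolvedSlope i P φ) _ (x, t, u) :=
      HasFDerivAt.comp (x, t, u) (g := P) hPd.hasFDerivAt h1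
    rw [h2.fderiv]
    simp [hv]
  -- From ∂I/∂q · ∂P/∂s = 1.
  have hq : fderiv ℝ I (x, t, u, p i) (0, 0, 0, 1) ≠ 0 := by
    intro h
    have h1 := hsolve (0, 0, 0, 1)
    have h2 : ((0, 0, 0, fderiv ℝ P τ (0, 0, 0, 1)) : ScalarJet n) =
        fderiv ℝ P τ (0, 0, 0, 1) • (0, 0, 0, 1) := by simp
    simp only at h1
    rw [h2, map_smul, h] at h1
    simp at h1
  rw [hchain _ (by simp)]
  simp only
  have h1 := hI.fderiv_apply_eq_zero hr x t u p hD
  have h2 := hsolve (-lam i u, 1, fun j => (lam j u - lam i u) * p j, 0)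
  simp only at h2
  set b := fderiv ℝ P τ (-lam i u, 1, fun j => (lam j u - lam i u) * p j, 0)
  set c := p i * fderiv ℝ (lam i) u p
  -- dI kills two vectors that differ only in the q-entry, b from the resolution and c from the
  -- Monge distribution; ∂I/∂q ≠ 0 forces b = c.
  have h3 : fderiv ℝ I (x, t, u, p i) ((b - c) • (0, 0, 0, 1)) = 0 := by
    rw [show (b - c) • ((0, 0, 0, 1) : ScalarJet n) =
      (-lam i u, 1, fun j => (lam j u - lam i u) * p j, b) -
        (-lam i u, 1, fun j => (lam j u - lam i u) * p j, c) by simp, map_sub, h1, h2, sub_zero]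
  rw [map_smul, smul_eq_mul] at h3
  exact sub_eq_zero.1 ((mul_eq_zero.1 h3).resolve_right hq)

/-! ### Linear algebra of tangent vectors. -/

/-- Decomposition of a vector with `du^j = p_j (dx + c_j dt)` along the `i`-th Monge direction. -/
theorem tangent_eq_smul_add_smul {p c : Fin n → ℝ} (i : Fin n) {v : Base n}
    (hv : ∀ j, v.2.2 j = p j * (v.1 + c j * v.2.1)) :
    v = (v.1 + c i * v.2.1) • ((1, 0, p) : Base n) +
      v.2.1 • (-c i, 1, fun j => (c j - c i) * p j) := by
  refine Prod.ext ?_ (Prod.ext ?_ (funext fun j => ?_))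
  · simp; ring
  · simp
  · simp only [Prod.snd_add, Prod.smul_snd, Pi.add_apply, Pi.smul_apply, smul_eq_mul, hv j]
    ring

/-- Here L stands for dp_i and l for dλ^i. The Monge equation `hL` leaves L(1, 0, p) as the only
undetermined value of L on tangent vectors. -/
theorem apply_tangent_eq {p c : Fin n → ℝ} (i : Fin n) (L : Base n →L[ℝ] ℝ)
    (l : (Fin n → ℝ) →L[ℝ] ℝ) (hL : L (-c i, 1, fun j => (c j - c i) * p j) = p i * l p)
    {v : Base n} (hv : ∀ j, v.2.2 j = p j * (v.1 + c j * v.2.1)) :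
    L v = (v.1 + c i * v.2.1) * L (1, 0, p) + v.2.1 * (p i * l p) ∧
      l v.2.2 = (v.1 + c i * v.2.1) * l p + v.2.1 * l fun j => (c j - c i) * p j := by
  have h := tangent_eq_smul_add_smul i hv
  constructor
  · conv_lhs => rw [h]
    rw [map_add, map_smul, map_smul, hL, smul_eq_mul, smul_eq_mul]
  · have h' := congrArg (fun v : Base n => v.2.2) h
    simp only [Prod.snd_add, Prod.smul_snd] at h'
    conv_lhs => rw [h']
    rw [map_add, map_smul, map_smul, smul_eq_mul, smul_eq_mul]

/-- The Monge equation for the slope makes `d(du - p (dx + c dt))` vanish on tangent vectors. -/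
theorem symm_of_monge_equation {p c : Fin n → ℝ} (i : Fin n) (L : Base n →L[ℝ] ℝ)
    (l : (Fin n → ℝ) →L[ℝ] ℝ) (hL : L (-c i, 1, fun j => (c j - c i) * p j) = p i * l p)
    {v w : Base n} (hv : ∀ j, v.2.2 j = p j * (v.1 + c j * v.2.1))
    (hw : ∀ j, w.2.2 j = p j * (w.1 + c j * w.2.1)) :
    L v * (w.1 + c i * w.2.1) + p i * l v.2.2 * w.2.1 =
      L w * (v.1 + c i * v.2.1) + p i * l w.2.2 * v.2.1 := by
  obtain ⟨hv1, hv2⟩ := apply_tangent_eq i L l hL hv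
  obtain ⟨hw1, hw2⟩ := apply_tangent_eq i L l hL hw
  -- With a = dx + c_i dt, only the products a(v)a(w), a(v)dt(w) + dt(v)a(w) and dt(v)dt(w) survive,
  -- all symmetric.
  rw [hv1, hv2, hw1, hw2]
  ring

/-- The coordinate differentials do not depend on the point, which brings the system into the shape
that the slope-form derivative lemmas treat. -/
theorem resolvedSystem_eq (lam : Fin n → (Fin n → ℝ) → ℝ) (P : Fin n → ScalarJet n → ℝ)
    (φ : Fin n → ℝ → ℝ) (i : Fin n) :
    ∃ du dx dt : Base n →L[ℝ] ℝ, (∀ v, du v = v.2.2 i) ∧ (∀ v, dx v = v.1) ∧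
      (∀ v, dt v = v.2.1) ∧ resolvedSystem lam P φ i =
        fun z => du - resolvedSlope i (P i) (φ i) z • (dx + lam i z.2.2 • dt) := by
  let dx : Base n →L[ℝ] ℝ := ContinuousLinearMap.fst ℝ _ _
  let dt : Base n →L[ℝ] ℝ := (ContinuousLinearMap.fst ℝ _ _).comp (ContinuousLinearMap.snd ℝ _ _)
  let du : Base n →L[ℝ] ℝ := (ContinuousLinearMap.proj i).comp
    ((ContinuousLinearMap.snd ℝ _ _).comp (ContinuousLinearMap.snd ℝ _ _))
  refine ⟨du, dx, dt, fun _ => rfl, fun _ => rfl, fun _ => rfl, funext fun z => ?_⟩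
  have h1 : fderiv ℝ (fun y : Base n => y.1) z = dx := dx.hasFDerivAt.fderiv
  have h2 : fderiv ℝ (fun y : Base n => y.2.1) z = dt := dt.hasFDerivAt.fderiv
  have h3 : fderiv ℝ (fun y : Base n => y.2.2 i) z = du := du.hasFDerivAt.fderiv
  simp only [resolvedSystem, h1, h2, h3, resolvedSlope]

/-- The slopes `p_i` in `partiallyResolvedSystem`. -/
noncomputable def partialSlope (m : Fin n) (P : Fin n → ScalarJet n → ℝ) (φ : Fin n → ℝ → ℝ)
    (i : Fin n) (z : ScalarJet n) : ℝ :=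
  if i = m then z.2.2.2 else resolvedSlope i (P i) (φ i) (z.1, z.2.1, z.2.2.1)

theorem partiallyResolvedSystem_eq (m : Fin n) (lam : Fin n → (Fin n → ℝ) → ℝ)
    (P : Fin n → ScalarJet n → ℝ) (φ : Fin n → ℝ → ℝ) (i : Fin n) :
    ∃ du dx dt : ScalarJet n →L[ℝ] ℝ, (∀ v, du v = v.2.2.1 i) ∧ (∀ v, dx v = v.1) ∧
      (∀ v, dt v = v.2.1) ∧ partiallyResolvedSystem m lam P φ i =
        fun z => du - partialSlope m P φ i z • (dx + lam i z.2.2.1 • dt) := by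
  let dx : ScalarJet n →L[ℝ] ℝ := ContinuousLinearMap.fst ℝ _ _
  let dt : ScalarJet n →L[ℝ] ℝ :=
    (ContinuousLinearMap.fst ℝ _ _).comp (ContinuousLinearMap.snd ℝ _ _)
  let du : ScalarJet n →L[ℝ] ℝ := (ContinuousLinearMap.proj i).comp
    ((ContinuousLinearMap.fst ℝ _ _).comp
      ((ContinuousLinearMap.snd ℝ _ _).comp (ContinuousLinearMap.snd ℝ _ _)))
  refine ⟨du, dx, dt, fun _ => rfl, fun _ => rfl, fun _ => rfl, funext fun z => ?_⟩
  have h1 : fderiv ℝ (fun y : ScalarJet n => y.1) z = dx := dx.hasFDerivAt.fderiv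
  have h2 : fderiv ℝ (fun y : ScalarJet n => y.2.1) z = dt := dt.hasFDerivAt.fderiv
  have h3 : fderiv ℝ (fun y : ScalarJet n => y.2.2.1 i) z = du := du.hasFDerivAt.fderiv
  simp only [partiallyResolvedSystem, h1, h2, h3, partialSlope, resolvedSlope]

theorem mem_pfaffDistribution_resolvedSystem {lam : Fin n → (Fin n → ℝ) → ℝ}
    {P : Fin n → ScalarJet n → ℝ} {φ : Fin n → ℝ → ℝ} {z v : Base n} :
    v ∈ pfaffDistribution (resolvedSystem lam P φ) z ↔
      ∀ j, v.2.2 j = resolvedSlope j (P j) (φ j) z * (v.1 + lam j z.2.2 * v.2.1) := by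
  rw [mem_pfaffDistribution]
  refine forall_congr' fun j => ?_
  obtain ⟨du, dx, dt, hdu, hdx, hdt, he⟩ := resolvedSystem_eq lam P φ j
  rw [he, ← sub_eq_zero (a := v.2.2 j)]
  simp [hdu, hdx, hdt, mul_add]

theorem mem_pfaffDistribution_partiallyResolvedSystem {m : Fin n}
    {lam : Fin n → (Fin n → ℝ) → ℝ} {P : Fin n → ScalarJet n → ℝ} {φ : Fin n → ℝ → ℝ}
    {z v : ScalarJet n} :
    v ∈ pfaffDistribution (partiallyResolvedSystem m lam P φ) z ↔
      ∀ j, v.2.2.1 j = partialSlope m P φ j z * (v.1 + lam j z.2.2.1 * v.2.1) := by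
  rw [mem_pfaffDistribution]
  refine forall_congr' fun j => ?_
  obtain ⟨du, dx, dt, hdu, hdx, hdt, he⟩ := partiallyResolvedSystem_eq m lam P φ j
  rw [he, ← sub_eq_zero (a := v.2.2.1 j)]
  simp [hdu, hdx, hdt, mul_add]

/-! ### Complete integrability. -/

/-- A system all of whose slopes satisfy the Monge equations is completely integrable. -/
theorem isFrobeniusIntegrable_resolvedSystem {U : Set (Fin n → ℝ)} (hU : IsOpen U)
    {lam : Fin n → (Fin n → ℝ) → ℝ} (hlam : ∀ i, ContDiffOn ℝ ∞ (lam i) U)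
    {P : Fin n → ScalarJet n → ℝ} {φ : Fin n → ℝ → ℝ} {W : Set (Base n)} (hW : IsOpen W)
    (hWU : ∀ z ∈ W, z.2.2 ∈ U)
    (hs : ∀ i, ∀ z ∈ W, ContDiffAt ℝ ∞ (resolvedSlope i (P i) (φ i)) z)
    (hM : ∀ i, ∀ z ∈ W, fderiv ℝ (resolvedSlope i (P i) (φ i)) z (-lam i z.2.2, 1, fun j =>
        (lam j z.2.2 - lam i z.2.2) * resolvedSlope j (P j) (φ j) z) =
      resolvedSlope i (P i) (φ i) z *
        fderiv ℝ (lam i) z.2.2 fun j => resolvedSlope j (P j) (φ j) z) :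
    IsFrobeniusIntegrable (resolvedSystem lam P φ) W := by
  have hlamz : ∀ i, ∀ z ∈ W, ContDiffAt ℝ ∞ (lam i) z.2.2 := fun i z hz =>
    (hlam i).contDiffAt (hU.mem_nhds (hWU z hz))
  have hlc : ∀ i, ∀ z ∈ W, ContDiffAt ℝ ∞ (fun y : Base n => lam i y.2.2) z := fun i z hz =>
    (hlamz i z hz).comp z contDiffAt_snd.snd
  have hld : ∀ i, ∀ z ∈ W, ∀ v, fderiv ℝ (fun y : Base n => lam i y.2.2) z v =
      fderiv ℝ (lam i) z.2.2 v.2.2 := by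
    intro i z hz v
    have h1 : HasFDerivAt (fun y : Base n => y.2.2) _ z := (hasFDerivAt_snd (𝕜 := ℝ) (p := z)).snd
    have h2 := HasFDerivAt.comp z (g := lam i)
      ((hlamz i z hz).differentiableAt (by simp)).hasFDerivAt h1
    exact DFunLike.congr_fun h2.fderiv v
  have hsd : ∀ i, ∀ z ∈ W, DifferentiableAt ℝ (resolvedSlope i (P i) (φ i)) z := fun i z hz =>
    (hs i z hz).differentiableAt (by simp)
  have hlcd : ∀ i, ∀ z ∈ W, DifferentiableAt ℝ (fun y : Base n => lam i y.2.2) z := fun i z hz =>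
    (hlc i z hz).differentiableAt (by simp)
  constructor
  · intro V hV hVW X Y hX hY z hz
    have hzW := hVW hz
    refine lieBracket_mem_pfaffDistribution (hV.mem_nhds hz) (fun i => ?_)
      ((hX.1.contDiffAt (hV.mem_nhds hz)).differentiableAt (by simp))
      ((hY.1.contDiffAt (hV.mem_nhds hz)).differentiableAt (by simp)) hX.2 hY.2 fun i => ?_
    all_goals obtain ⟨du, dx, dt, hdu, hdx, hdt, he⟩ := resolvedSystem_eq lam P φ i
    · rw [he]
      exact differentiableAt_slopeForm du dx dt (hsd i z hzW) (hlcd i z hzW)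
    · rw [he, fderiv_slopeForm_apply du dx dt (hsd i z hzW) (hlcd i z hzW),
        fderiv_slopeForm_apply du dx dt (hsd i z hzW) (hlcd i z hzW), hld i z hzW, hld i z hzW]
      simp only [hdx, hdt]
      rw [symm_of_monge_equation (p := fun j => resolvedSlope j (P j) (φ j) z)
        (c := fun j => lam j z.2.2) i _ (fderiv ℝ (lam i) z.2.2) (hM i z hzW)
        (mem_pfaffDistribution_resolvedSystem.1 (hX.2 z hz))
        (mem_pfaffDistribution_resolvedSystem.1 (hY.2 z hz))]
  · intro z₀ hz₀
    -- The total derivatives along x and t. Their x- and t-components are constant, so only the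
    -- u-components of the bracket need checking.
    let X : Base n → Base n := fun z => (1, 0, fun j => resolvedSlope j (P j) (φ j) z)
    let Y : Base n → Base n := fun z =>
      (0, 1, fun j => resolvedSlope j (P j) (φ j) z * lam j z.2.2)
    have hX : ContDiffOn ℝ ∞ X W := fun z hz => (contDiffAt_const.prodMk
      (contDiffAt_const.prodMk (contDiffAt_pi.2 fun j => hs j z hz))).contDiffWithinAt
    have hY : ContDiffOn ℝ ∞ Y W := fun z hz => (contDiffAt_const.prodMk
      (contDiffAt_const.prodMk
        (contDiffAt_pi.2 fun j => (hs j z hz).mul (hlc j z hz)))).contDiffWithinAt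
    refine hasIntegralManifoldAt_of_commute hW hX hY ?_ ?_ ?_ hz₀
    · intro z hz
      have dX : HasFDerivAt X _ z := (hasFDerivAt_const (1 : ℝ) z).prodMk
        ((hasFDerivAt_const (0 : ℝ) z).prodMk
          (hasFDerivAt_pi.2 fun j => (hsd j z hz).hasFDerivAt))
      have dY : HasFDerivAt Y _ z := (hasFDerivAt_const (0 : ℝ) z).prodMk
        ((hasFDerivAt_const (1 : ℝ) z).prodMk
          (hasFDerivAt_pi.2 fun j => (hsd j z hz).hasFDerivAt.mul (hlcd j z hz).hasFDerivAt))
      rw [dX.fderiv, dY.fderiv]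
      refine Prod.ext rfl (Prod.ext rfl (funext fun j => ?_))
      -- Y decomposes as λ^j X plus the j-th Monge direction, so Y(p_j) = λ^j X(p_j) + p_j X(λ^j) =
      -- X(λ^j p_j).
      have key := apply_tangent_eq (p := fun j => resolvedSlope j (P j) (φ j) z)
        (c := fun j => lam j z.2.2) j _ (fderiv ℝ (lam j) z.2.2) (hM j z hz) (v := Y z)
        (fun k => by simp [Y])
      have : fderiv ℝ (resolvedSlope j (P j) (φ j)) z (Y z) =
          resolvedSlope j (P j) (φ j) z * fderiv ℝ (fun y : Base n => lam j y.2.2) z (X z) +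
            lam j z.2.2 * fderiv ℝ (resolvedSlope j (P j) (φ j)) z (X z) := by
        rw [key.1, hld j z hz]
        simp only [X, Y]
        ring
      simpa using this
    · intro z _ a b h
      have h1 := congrArg (fun v : Base n => v.1) h
      have h2 := congrArg (fun v : Base n => v.2.1) h
      simp [X, Y] at h1 h2
      exact ⟨h1, h2⟩
    · intro z _ v
      rw [mem_pfaffDistribution_resolvedSystem]
      constructor
      · intro h
        refine ⟨v.1, v.2.1, Prod.ext (by simp [X, Y]) (Prod.ext (by simp [X, Y])
          (funext fun j => ?_))⟩
        rw [h j]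
        simp [X, Y]
        ring
      · rintro ⟨a, b, rfl⟩ j
        simp [X, Y]
        ring

/-! ### The Cauchy characteristic. -/

/-- If all slopes but the `m`-th satisfy the Monge equations, the system admits a Cauchy
characteristic. -/
theorem hasCauchyCharacteristic_partiallyResolvedSystem (hr : 1 ≤ r) (hr' : r + 1 ≤ r)
    (m : Fin n) {U : Set (Fin n → ℝ)} (hU : IsOpen U)
    {lam : Fin n → (Fin n → ℝ) → ℝ} (hlam : ∀ i, ContDiffOn ℝ r (lam i) U)
    {P : Fin n → ScalarJet n → ℝ} {φ : Fin n → ℝ → ℝ} {W : Set (ScalarJet n)}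
    (hWU : ∀ z ∈ W, z.2.2.1 ∈ U)
    (hs : ∀ i, i ≠ m → ∀ z ∈ W,
      ContDiffAt ℝ r (resolvedSlope i (P i) (φ i)) (z.1, z.2.1, z.2.2.1))
    (hM : ∀ i, i ≠ m → ∀ z ∈ W, fderiv ℝ (resolvedSlope i (P i) (φ i)) (z.1, z.2.1, z.2.2.1)
        (-lam i z.2.2.1, 1, fun j =>
          (lam j z.2.2.1 - lam i z.2.2.1) * partialSlope m P φ j z) =
      partialSlope m P φ i z * fderiv ℝ (lam i) z.2.2.1 fun j => partialSlope m P φ j z) :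
    HasCauchyCharacteristic r (partiallyResolvedSystem m lam P φ) W := by
  have hr0 : r ≠ 0 := by rintro rfl; simp at hr
  let π : ScalarJet n → Base n := fun z => (z.1, z.2.1, z.2.2.1)
  have hπ : ContDiff ℝ r π := contDiff_fst.prodMk (contDiff_snd.fst.prodMk contDiff_snd.snd.fst)
  have hπd : ∀ z, ∃ L : ScalarJet n →L[ℝ] Base n, HasFDerivAt π L z ∧ ∀ v, L v = π v := fun z =>
    ⟨_, hasFDerivAt_fst.prodMk ((hasFDerivAt_snd (𝕜 := ℝ) (p := z)).fst.prodMk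
      (hasFDerivAt_snd (𝕜 := ℝ) (p := z)).snd.fst), fun v => rfl⟩
  have hlamz : ∀ i, ∀ z ∈ W, ContDiffAt ℝ r (lam i) z.2.2.1 := fun i z hz =>
    (hlam i).contDiffAt (hU.mem_nhds (hWU z hz))
  have hu : ContDiff ℝ r (fun y : ScalarJet n => y.2.2.1) := contDiff_snd.snd.fst
  have hlc : ∀ i, ∀ z ∈ W, ContDiffAt ℝ r (fun y : ScalarJet n => lam i y.2.2.1) z :=
    fun i z hz => (hlamz i z hz).comp z hu.contDiffAt
  have hld : ∀ i, ∀ z ∈ W, ∀ v, fderiv ℝ (fun y : ScalarJet n => lam i y.2.2.1) z v =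
      fderiv ℝ (lam i) z.2.2.1 v.2.2.1 := by
    intro i z hz v
    have h1 : HasFDerivAt (fun y : ScalarJet n => y.2.2.1) _ z :=
      (hasFDerivAt_snd (𝕜 := ℝ) (p := z)).snd.fst
    have h2 := HasFDerivAt.comp z (g := lam i)
      ((hlamz i z hz).differentiableAt hr0).hasFDerivAt h1
    exact DFunLike.congr_fun h2.fderiv v
  have hlcd : ∀ i, ∀ z ∈ W, DifferentiableAt ℝ (fun y : ScalarJet n => lam i y.2.2.1) z :=
    fun i z hz => (hlc i z hz).differentiableAt hr0
  have hself : partialSlope m P φ m = fun z => z.2.2.2 := funext fun z => if_pos rfl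
  have hne : ∀ i, i ≠ m → partialSlope m P φ i = resolvedSlope i (P i) (φ i) ∘ π :=
    fun i hi => funext fun z => if_neg hi
  have hpc : ∀ i, ∀ z ∈ W, ContDiffAt ℝ r (partialSlope m P φ i) z := by
    intro i z hz
    rcases eq_or_ne i m with rfl | hi
    · rw [hself]
      exact contDiffAt_snd.snd.snd
    · rw [hne i hi]
      exact (hs i hi z hz).comp z hπ.contDiffAt
  have hpcd : ∀ i, ∀ z ∈ W, DifferentiableAt ℝ (partialSlope m P φ i) z := fun i z hz =>
    (hpc i z hz).differentiableAt hr0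
  have hpd : ∀ i, i ≠ m → ∀ z ∈ W, ∀ v, fderiv ℝ (partialSlope m P φ i) z v =
      fderiv ℝ (resolvedSlope i (P i) (φ i)) (π z) (π v) := by
    intro i hi z hz v
    obtain ⟨L, hL, hLv⟩ := hπd z
    rw [hne i hi, (HasFDerivAt.comp z ((hs i hi z hz).differentiableAt hr0).hasFDerivAt hL).fderiv,
      ContinuousLinearMap.comp_apply, hLv]
  have hpdm : ∀ z v, fderiv ℝ (partialSlope m P φ m) z v = v.2.2.2 := by
    intro z v
    have h1 : HasFDerivAt (fun y : ScalarJet n => y.2.2.2) _ z :=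
      (hasFDerivAt_snd (𝕜 := ℝ) (p := z)).snd.snd
    rw [hself, h1.fderiv]
    rfl
  -- The m-th Monge direction; the last entry is the value of du^m_x that the Monge distribution
  -- prescribes for dt = 1.
  let C : ScalarJet n → ScalarJet n := fun z =>
    (-lam m z.2.2.1, 1, fun j => (lam j z.2.2.1 - lam m z.2.2.1) * partialSlope m P φ j z,
      z.2.2.2 * fderiv ℝ (lam m) z.2.2.1 fun j => partialSlope m P φ j z)
  have hC : ∀ z ∈ W, ContDiffAt ℝ r C z := by
    intro z hz
    have h1 : ContDiffAt ℝ r (fun y : ScalarJet n => fderiv ℝ (lam m) y.2.2.1) z :=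
      ContDiffAt.comp z (g := fderiv ℝ (lam m)) (((hlam m).fderiv_of_isOpen hU hr').contDiffAt
        (hU.mem_nhds (hWU z hz))) hu.contDiffAt
    have h2 : ContDiffAt ℝ r (fun y j => partialSlope m P φ j y) z :=
      contDiffAt_pi.2 fun j => hpc j z hz
    have h3 : ContDiffAt ℝ r (fun y : ScalarJet n => y.2.2.2) z := contDiffAt_snd.snd.snd
    exact (hlc m z hz).neg.prodMk (contDiffAt_const.prodMk
      ((contDiffAt_pi.2 fun j => ((hlc j z hz).sub (hlc m z hz)).mul (hpc j z hz)).prodMk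
        (h3.mul (h1.clm_apply h2))))
  have hCt : ∀ z, C z ∈ pfaffDistribution (partiallyResolvedSystem m lam P φ) z := fun z =>
    mem_pfaffDistribution_partiallyResolvedSystem.2 fun j => by simp only [C]; ring
  refine ⟨C, fun z hz => (hC z hz).contDiffWithinAt, fun z _ => ⟨fun h => ?_, hCt z⟩, ?_⟩
  · simpa [C] using congrArg (fun v : ScalarJet n => v.2.1) h
  · intro V hV hVW Y hY z hz
    have hzW := hVW hz
    refine lieBracket_mem_pfaffDistribution (hV.mem_nhds hz) (fun i => ?_)
      ((hC z hzW).differentiableAt hr0)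
      ((hY.1.contDiffAt (hV.mem_nhds hz)).differentiableAt (by simp)) (fun y _ => hCt y) hY.2
      fun i => ?_
    all_goals obtain ⟨du, dx, dt, hdu, hdx, hdt, he⟩ := partiallyResolvedSystem_eq m lam P φ i
    · rw [he]
      exact differentiableAt_slopeForm du dx dt (hpcd i z hzW) (hlcd i z hzW)
    · have hYz := mem_pfaffDistribution_partiallyResolvedSystem.1 (hY.2 z hz)
      have hCz := mem_pfaffDistribution_partiallyResolvedSystem.1 (hCt z)
      rw [he, fderiv_slopeForm_apply du dx dt (hpcd i z hzW) (hlcd i z hzW),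
        fderiv_slopeForm_apply du dx dt (hpcd i z hzW) (hlcd i z hzW), hld i z hzW, hld i z hzW]
      simp only [hdx, hdt]
      rcases eq_or_ne i m with rfl | hi
      -- Since dx + λ^m dt vanishes on C, the unknown du^m_x(Y) drops out of dθ^m(C, Y), and the
      -- last entry of C cancels what is left.
      · have key := tangent_eq_smul_add_smul (p := fun j => partialSlope i P φ j z)
          (c := fun j => lam j z.2.2.1) i (v := π (Y z)) hYz
        have h1 := congrArg (fun v : Base n => fderiv ℝ (lam i) z.2.2.1 v.2.2) key
        simp only [Prod.snd_add, Prod.smul_snd, map_add, map_smul, smul_eq_mul, π] at h1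
        rw [hpdm, hpdm, h1, hself]
        simp only [C]
        ring
      -- For i ≠ m neither p_i nor λ^i depends on u^m_x, so the question descends to (x, t, u).
      · rw [hpd i hi z hzW, hpd i hi z hzW]
        have key := symm_of_monge_equation (p := fun j => partialSlope m P φ j z)
          (c := fun j => lam j z.2.2.1) i _ (fderiv ℝ (lam i) z.2.2.1) (hM i hi z hzW)
          (v := π (C z)) (w := π (Y z)) hCz hYz
        exact congrArg Neg.neg key

end MongeSystems

/-! ### Assembly of both assertions. -/

theorem proposition3 {n : ℕ} (r : WithTop ℕ∞) (hr : ∞ ≤ r)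
    (U : Set (Fin n → ℝ)) (hU : IsOpen U)
    (lam : Fin n → (Fin n → ℝ) → ℝ) (hlam : ∀ i, ContDiffOn ℝ r (lam i) U)
    (D : Fin n → Set (ScalarJet n)) (I : Fin n → ScalarJet n → ℝ)
    (O : Fin n → Set (ScalarJet n)) (P : Fin n → ScalarJet n → ℝ)
    (J : Fin n → Set ℝ) (φ : Fin n → ℝ → ℝ) :
    -- all Monge distributions have a second Riemann invariant
    ((∀ i, IsSecondRiemannInvariant r U lam i (D i) (I i)) →
      (∀ i, IsResolution r (D i) (I i) (O i) (P i)) →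
      (∀ i, IsOpen (J i) ∧ ContDiffOn ℝ r (φ i) (J i)) →
      ∀ W : Set (Base n), IsOpen W →
        (∀ z ∈ W, z.2.2 ∈ U ∧
          ∀ i, z.2.2 i ∈ J i ∧ (z.1, z.2.1, z.2.2, φ i (z.2.2 i)) ∈ O i) →
        IsFrobeniusIntegrable (resolvedSystem lam P φ) W) ∧
    -- all Monge distributions but the `m`-th have a second Riemann invariant
    (∀ m : Fin n,
      (∀ i, i ≠ m → IsSecondRiemannInvariant r U lam i (D i) (I i)) →
      (∀ i, i ≠ m → IsResolution r (D i) (I i) (O i) (P i)) →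
      (∀ i, i ≠ m → IsOpen (J i) ∧ ContDiffOn ℝ r (φ i) (J i)) →
      ∀ W : Set (ScalarJet n), IsOpen W →
        (∀ z ∈ W, z.2.2.1 ∈ U ∧
          ∀ i, i ≠ m → z.2.2.1 i ∈ J i ∧
            (z.1, z.2.1, z.2.2.1, φ i (z.2.2.1 i)) ∈ O i) →
        HasCauchyCharacteristic r (partiallyResolvedSystem m lam P φ) W) := by

  have hr1 : 1 ≤ r := le_trans (by simp) hr
  -- Only r = ∞ and r = ω are possible, so dλ^m, which enters the characteristic, is again of class
  -- r; this covers the analytic case.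
  have hr' : r + 1 ≤ r := by
    rcases eq_or_ne r ∞ with rfl | h
    · exact le_rfl
    · have : r = ω := by
        cases r with
        | top => rfl
        | coe a =>
          have : (⊤ : ℕ∞) ≤ a := by exact_mod_cast hr
          exact absurd (by rw [top_le_iff.1 this]) h
      subst this
      exact le_top
  constructor
  · intro hI hP hφ W hW hWm
    refine isFrobeniusIntegrable_resolvedSystem hU (fun i => (hlam i).of_le hr) hW
      (fun z hz => (hWm z hz).1) (fun i z hz => ?_) fun i z hz => ?_
    · obtain ⟨hJ, hO⟩ := (hWm z hz).2 i
      exact (contDiffAt_resolvedSlope (hP i).isOpen (hP i).contDiffOn (hφ i).1 (hφ i).2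
        hJ hO).of_le hr
    · obtain ⟨hJ, hO⟩ := (hWm z hz).2 i
      exact fderiv_resolvedSlope_apply hr1 (hI i) (hP i)
        (((hφ i).2.contDiffAt ((hφ i).1.mem_nhds hJ)).differentiableAt (by
          rintro rfl; simp at hr1)) hO (fun j => resolvedSlope j (P j) (φ j) z) rfl
  · intro m hI hP hφ W _ hWm
    refine hasCauchyCharacteristic_partiallyResolvedSystem hr1 hr' m hU hlam
      (fun z hz => (hWm z hz).1) (fun i hi z hz => ?_) fun i hi z hz => ?_
    · obtain ⟨hJ, hO⟩ := (hWm z hz).2 i hi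
      exact contDiffAt_resolvedSlope (hP i hi).isOpen (hP i hi).contDiffOn (hφ i hi).1
        (hφ i hi).2 hJ hO
    · obtain ⟨hJ, hO⟩ := (hWm z hz).2 i hi
      -- The m-th entry of p is the free coordinate u^m_x; the Monge equation only ties p i to the
      -- resolved slope.
      exact fderiv_resolvedSlope_apply (z := (z.1, z.2.1, z.2.2.1)) hr1 (hI i hi) (hP i hi)
        (((hφ i hi).2.contDiffAt ((hφ i hi).1.mem_nhds hJ)).differentiableAt (by
          rintro rfl; simp at hr1)) hO (fun j => partialSlope m P φ j z) (if_neg hi)
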